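/- Let $n\in\mathbb N$ and let $\Gamma_0(\mathbb R^n)$ be the set of proper, lower semicontinuous, convex functions $f:\mathbb R^n\to\mathbb R\cup\{+\infty\}$. For $f\in\Gamma_0(\mathbb R^n)$ let $e_1f(x)=\inf_{y}\{f(y)+\tfrac12\|y-x\|^2\}$ be its Moreau envelope (with $\|\cdot\|$ the Euclidean norm), and for $f,g\in\Gamma_0(\mathbb R^n)$ put $$d(f,g)=\sum_{i=1}^\infty\frac1{2^i}\,\frac{\|e_1f-e_1g\|_i}{1+\|e_1f-e_1g\|_i},\qquad \|e_1f-e_1g\|_i=\sup_{\|x\|\le i}|e_1f(x)-e_1g(x)|.$$ A function $f$ attains a strong minimum at $\bar x$ if $f(\bar x)\le f(x)$ for all $x\in\operatorname{dom} f$ and, for every sequence $(x_k)$, $f(x_k)\to f(\bar x)$ implies $x_k\to\bar x$. Then $d$ is a metric on $\Gamma_0(\mathbb R^n)$, the metric space $(\Gamma_0(\mathbb R^n),d)$ is complete, and in this space the set $$S=\{f\in\Gamma_0(\mathbb R^n): f\text{ attains a strong minimum at some point of }\mathbb R^n\}$$ is generic, i.e. its complement $\Gamma_0(\mathbb R^n)\setminus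 S$ is of first category (a countable union of nowhere dense sets). -/

import Mathlib

open Filter Topology

/-- Euclidean space `ℝⁿ`, with the Euclidean inner product and norm. -/
abbrev Rn (n : ℕ) : Type := EuclideanSpace ℝ (Fin n)

/-- Proper: the value `-∞` is not taken, and the effective domain `{x | f x < ∞}` is nonempty. -/
def IsProperFun {n : ℕ} (f : Rn n → EReal) : Prop :=
  (∀ x, f x ≠ ⊥) ∧ ∃ x, f x < ⊤

/-- Convexity, by the convexity inequality at points of the effective domain. For a proper `f`, the
right-hand side only involves real numbers. -/
def IsConvexFun {n : ℕ} (f : Rn n → EReal) : Prop :=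
  ∀ x y : Rn n, f x < ⊤ → f y < ⊤ → ∀ α : ℝ, 0 ≤ α → α ≤ 1 →
    f (α • x + (1 - α) • y) ≤ (α : EReal) * f x + ((1 - α : ℝ) : EReal) * f y

/-- `Γ₀(ℝⁿ)`, the proper lower semicontinuous convex functions on `ℝⁿ`. A structure (rather than a
subtype of the function space), so that it carries no topology by default. -/
@[ext]
structure Gamma0 (n : ℕ) where
  toFun : Rn n → EReal
  proper : IsProperFun toFun
  lsc : LowerSemicontinuous toFun
  convex : IsConvexFun toFun

/-- The Moreau envelope `e_r f (x) = inf_y (f y + ‖y - x‖² / (2r))`. -/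
noncomputable def moreauEnvelope {n : ℕ} (r : ℝ) (f : Rn n → EReal) (x : Rn n) : EReal :=
  ⨅ y : Rn n, f y + ((1 / (2 * r) * ‖y - x‖ ^ 2 : ℝ) : EReal)

/-- `sup_{‖x‖ ≤ ρ} |e₁f(x) - e₁g(x)|`. For `f, g ∈ Γ₀(ℝⁿ)` both envelopes are finite and continuous
on the whole space, so neither `toReal` nor the real supremum over the ball takes a default value. -/
noncomputable def envelopeSup {n : ℕ} (ρ : ℝ) (f g : Gamma0 n) : ℝ :=
  ⨆ x : Metric.closedBall (0 : Rn n) ρ,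
    |(moreauEnvelope 1 f.toFun x).toReal - (moreauEnvelope 1 g.toFun x).toReal|

/-- The Attouch–Wets distance `∑_{i ≥ 1} 2⁻ⁱ N_i / (1 + N_i)` with
`N_i = sup_{‖x‖ ≤ i} |e₁f(x) - e₁g(x)|`; the index is shifted, `i = k + 1`. -/
noncomputable def attouchWetsDist {n : ℕ} (f g : Gamma0 n) : ℝ :=
  ∑' k : ℕ, 1 / 2 ^ (k + 1) *
    (envelopeSup ((k + 1 : ℕ) : ℝ) f g / (1 + envelopeSup ((k + 1 : ℕ) : ℝ) f g))

/-- `f` attains a strong minimum at `a`: `a` is a minimizer, and `f (x_k) → f a` forces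
`x_k → a`. -/
def AttainsStrongMinAt {n : ℕ} (f : Rn n → EReal) (a : Rn n) : Prop :=
  (∀ x, f x < ⊤ → f a ≤ f x) ∧
    ∀ x : ℕ → Rn n, Tendsto (fun k => f (x k)) atTop (𝓝 (f a)) → Tendsto x atTop (𝓝 a)

/-! Everything is transported to Moreau envelopes. The map `f ↦ f.env` is injective, since `f y =
sup_x (f.env x - ‖x - y‖²/2)`, and its range is described intrinsically by `IsMoreauEnv`: convex,
and touched from above at every point by a paraboloid of curvature 1. Convergence in `d` is uniform
convergence of envelopes on balls, so `d` is a metric. `IsMoreauEnv` survives pointwise limits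
(`IsMoreauEnv.of_tendsto`), which gives completeness.

For genericity, `f` and `f.env` have the same minimizers and infimum. If for every `m` the envelope
has a well of radius `1/(m+1)`, convexity traps its low sublevel sets in balls of that radius, and
`f` has a strong minimum. Wells survive small perturbations, so each condition is open. It is dense
because mixing a little `‖x‖²/4` into an envelope yields a strongly convex envelope, which has wells
of every radius. A countable intersection of dense open sets is residual. -/

namespace Gamma0

variable {n : ℕ} (f : Gamma0 n)

/-! ### Proximal points and finiteness of the envelope. -/

theorem exists_coe_eq {x : Rn n} (hx : f.toFun x < ⊤) : ∃ a : ℝ, f.toFun x = a :=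
  ⟨(f.toFun x).toReal, (EReal.coe_toReal hx.ne (f.proper.1 x)).symm⟩

theorem exists_mem_dom : ∃ (x : Rn n) (a : ℝ), f.toFun x = a := by
  obtain ⟨x, hx⟩ := f.proper.2
  exact ⟨x, f.exists_coe_eq hx⟩

theorem le_combo {x y : Rn n} {a b α : ℝ} (hx : f.toFun x ≤ a) (hy : f.toFun y ≤ b)
    (h0 : 0 ≤ α) (h1 : α ≤ 1) :
    f.toFun (α • x + (1 - α) • y) ≤ ((α * a + (1 - α) * b : ℝ) : EReal) := by
  obtain ⟨a', ha⟩ := f.exists_coe_eq (hx.trans_lt (EReal.coe_lt_top a))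
  obtain ⟨b', hb⟩ := f.exists_coe_eq (hy.trans_lt (EReal.coe_lt_top b))
  have h := f.convex x y (ha ▸ EReal.coe_lt_top a') (hb ▸ EReal.coe_lt_top b') α h0 h1
  rw [ha, hb] at h
  rw [ha] at hx
  rw [hb] at hy
  refine h.trans ?_
  norm_cast at hx hy ⊢
  have := mul_le_mul_of_nonneg_left hx h0
  have := mul_le_mul_of_nonneg_left hy (sub_nonneg.2 h1)
  linarith

/-- A function in `Γ₀(ℝⁿ)` decreases at most linearly. -/
theorem exists_linear_lower_bound (y : Rn n) :
    ∃ C k : ℝ, 0 ≤ C ∧ 0 ≤ k ∧ ∀ z, ((-C - k * ‖z - y‖ : ℝ) : EReal) ≤ f.toFun z := by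
  obtain ⟨x₀, a, ha⟩ := f.exists_mem_dom
  obtain ⟨p, -, hp⟩ := LowerSemicontinuousOn.exists_isMinOn
    (Metric.nonempty_closedBall.2 zero_le_one : (Metric.closedBall x₀ 1).Nonempty)
    (isCompact_closedBall x₀ 1) (f.lsc.lowerSemicontinuousOn _)
  have hpx : f.toFun p ≤ f.toFun x₀ := hp (Metric.mem_closedBall_self zero_le_one)
  obtain ⟨m, hm⟩ := f.exists_coe_eq (hpx.trans_lt (ha ▸ EReal.coe_lt_top a))
  have hma : m ≤ a := by rw [ha, hm] at hpx; exact_mod_cast hpx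
  -- Outside the unit ball, the segment from `x₀` to `z` crosses the unit sphere, where `f ≥ m`;
  -- convexity then bounds `f z` below.
  have key : ∀ z, ((m - (a - m) * ‖z - x₀‖ : ℝ) : EReal) ≤ f.toFun z := by
    intro z
    by_cases hz : ‖z - x₀‖ ≤ 1
    · have : f.toFun p ≤ f.toFun z := hp (by simpa [dist_eq_norm] using hz)
      rw [hm] at this
      refine le_trans ?_ this
      norm_cast
      nlinarith [norm_nonneg (z - x₀)]
    · push Not at hz
      by_cases htop : f.toFun z < ⊤
      swap
      · rw [not_lt_top_iff.1 htop]; exact le_top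
      obtain ⟨b, hb⟩ := f.exists_coe_eq htop
      set t := ‖z - x₀‖ with ht
      have ht0 : 0 < t := by linarith
      have h1 := f.le_combo hb.le ha.le (inv_nonneg.2 ht0.le) (inv_le_one_of_one_le₀ hz.le)
      have h2 : f.toFun p ≤ f.toFun (t⁻¹ • z + (1 - t⁻¹) • x₀) := by
        apply hp
        have : t⁻¹ • z + (1 - t⁻¹) • x₀ - x₀ = t⁻¹ • (z - x₀) := by module
        rw [Metric.mem_closedBall, dist_eq_norm, this, norm_smul, ← ht, norm_inv, norm_norm,
          inv_mul_cancel₀ ht0.ne']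
      rw [hm] at h2
      have h3 : m ≤ t⁻¹ * b + (1 - t⁻¹) * a := by exact_mod_cast h2.trans h1
      have h4 : t * m ≤ b + (t - 1) * a := by
        have := mul_le_mul_of_nonneg_left h3 ht0.le
        have e : t * (t⁻¹ * b + (1 - t⁻¹) * a) = b + (t - 1) * a := by field_simp
        linarith
      rw [hb]
      norm_cast
      nlinarith
  refine ⟨|m| + (a - m) * ‖y - x₀‖, a - m, by have := sub_nonneg.2 hma; positivity,
    sub_nonneg.2 hma, fun z => le_trans ?_ (key z)⟩
  norm_cast
  have h1 := norm_sub_le_norm_sub_add_norm_sub z y x₀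
  have h2 := mul_le_mul_of_nonneg_left h1 (sub_nonneg.2 hma)
  have h3 := neg_abs_le m
  linarith

/-- Existence of proximal points. -/
theorem exists_prox {c : ℝ} (hc : 0 < c) (x : Rn n) :
    ∃ (p : Rn n) (a : ℝ), f.toFun p = a ∧
      ∀ z, ((a + c * ‖p - x‖ ^ 2 : ℝ) : EReal) ≤ f.toFun z + ((c * ‖z - x‖ ^ 2 : ℝ) : EReal) := by
  obtain ⟨x₀, a, ha⟩ := f.exists_mem_dom
  obtain ⟨C, k, hC, hk, hf⟩ := f.exists_linear_lower_bound x
  set G : Rn n → EReal := fun z => f.toFun z + ((c * ‖z - x‖ ^ 2 : ℝ) : EReal) with hG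
  have hGlsc : LowerSemicontinuous G := by
    refine f.lsc.add' (Continuous.lowerSemicontinuous ?_) fun z => ?_
    · exact continuous_coe_real_ereal.comp (by fun_prop)
    · exact EReal.continuousAt_add (Or.inr (EReal.coe_ne_bot _)) (Or.inr (EReal.coe_ne_top _))
  set D : ℝ := a + c * ‖x₀ - x‖ ^ 2 with hD
  have hGx₀ : G x₀ = D := by simp only [hG, ha, hD]; norm_cast
  -- Beyond radius `R` the quadratic term beats the linear decay of `f` and the value `D`, so a
  -- minimizer on the ball is global.
  set R : ℝ := ‖x₀ - x‖ + 1 + (k + C + |D|) / c with hR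
  have hR0 : 0 ≤ (k + C + |D|) / c := by positivity
  have hx₀R : x₀ ∈ Metric.closedBall x R := by
    rw [Metric.mem_closedBall, dist_eq_norm]; linarith
  obtain ⟨p, -, hp⟩ := LowerSemicontinuousOn.exists_isMinOn ⟨x₀, hx₀R⟩
    (isCompact_closedBall x R) (hGlsc.lowerSemicontinuousOn _)
  have hmin : ∀ z, G p ≤ G z := by
    intro z
    by_cases hz : z ∈ Metric.closedBall x R
    · exact hp hz
    · refine (hp hx₀R : G p ≤ G x₀).trans ?_
      rw [hGx₀]
      refine le_trans ?_ (add_le_add_left (hf z) _)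
      rw [Metric.mem_closedBall, dist_eq_norm, not_le] at hz
      norm_cast
      have h0 := norm_nonneg (x₀ - x)
      have h1 : 1 ≤ ‖z - x‖ := by linarith
      have h2 : k + C + |D| ≤ c * ‖z - x‖ := by
        have : (k + C + |D|) / c ≤ ‖z - x‖ := by linarith
        rwa [div_le_iff₀' hc] at this
      have h3 := mul_le_mul_of_nonneg_right h2 (norm_nonneg (z - x))
      have h4 := le_abs_self D
      have h5 := abs_nonneg D
      nlinarith
  have hptop : f.toFun p < ⊤ := by
    by_contra h
    have := hmin x₀
    rw [hGx₀] at this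
    simp only [hG, not_lt_top_iff.1 h] at this
    rw [EReal.top_add_coe] at this
    exact absurd this (not_le.2 (EReal.coe_lt_top _))
  obtain ⟨b, hb⟩ := f.exists_coe_eq hptop
  refine ⟨p, b, hb, fun z => ?_⟩
  have := hmin z
  simp only [hG, hb] at this
  exact_mod_cast this

/-- The Moreau envelope with parameter `1`, as a real-valued function. -/
noncomputable def env (x : Rn n) : ℝ := (moreauEnvelope 1 f.toFun x).toReal

theorem exists_env_prox (x : Rn n) :
    ∃ (p : Rn n) (a : ℝ), f.toFun p = a ∧ f.env x = a + 1 / 2 * ‖p - x‖ ^ 2 ∧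
      moreauEnvelope 1 f.toFun x = (f.env x : EReal) := by
  obtain ⟨p, a, ha, hp⟩ := f.exists_prox (c := 1 / 2) (by norm_num) x
  have h : moreauEnvelope 1 f.toFun x = ((a + 1 / 2 * ‖p - x‖ ^ 2 : ℝ) : EReal) := by
    unfold moreauEnvelope
    rw [mul_one]
    refine le_antisymm ((iInf_le _ p).trans ?_) (le_iInf hp)
    rw [ha]
    norm_cast
  refine ⟨p, a, ha, ?_, ?_⟩
  · rw [env, h, EReal.toReal_coe]
  · rw [env, h, EReal.toReal_coe]

theorem env_le_of_le {z : Rn n} {b : ℝ} (hz : f.toFun z ≤ b) (x : Rn n) :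
    f.env x ≤ b + 1 / 2 * ‖z - x‖ ^ 2 := by
  obtain ⟨-, -, -, -, h⟩ := f.exists_env_prox x
  have h1 : moreauEnvelope 1 f.toFun x ≤ f.toFun z + ((1 / 2 * ‖z - x‖ ^ 2 : ℝ) : EReal) := by
    unfold moreauEnvelope
    rw [mul_one]
    exact iInf_le _ z
  rw [h] at h1
  exact_mod_cast h1.trans (add_le_add_left hz _)

end Gamma0

/-! ### Envelopes: inversion formula and range. -/

/-- The real functions that arise as Moreau envelopes (with parameter `1`) of functions in
`Γ₀(ℝⁿ)`: convex, and touched from above at each point by a paraboloid of curvature `1`. -/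
structure IsMoreauEnv {n : ℕ} (φ : Rn n → ℝ) : Prop where
  convex : ConvexOn ℝ Set.univ φ
  touch : ∀ x, ∃ v, ∀ z, φ z ≤ φ x + inner ℝ v (z - x) + 1 / 2 * ‖z - x‖ ^ 2

namespace Gamma0

variable {n : ℕ} (f : Gamma0 n)

/-- Proximal points serve as competitors: their convex combination gives convexity, and freezing the
one of `x` gives the touching paraboloid. -/
theorem isMoreauEnv_env : IsMoreauEnv f.env := by
  refine ⟨⟨convex_univ, ?_⟩, fun x => ?_⟩
  · intro x _ y _ α β hα hβ hαβ
    obtain ⟨p, a, ha, hp, -⟩ := f.exists_env_prox x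
    obtain ⟨q, b, hb, hq, -⟩ := f.exists_env_prox y
    obtain rfl : β = 1 - α := by linarith
    have h := f.env_le_of_le (f.le_combo ha.le hb.le hα (by linarith)) (α • x + (1 - α) • y)
    have e : α • p + (1 - α) • q - (α • x + (1 - α) • y) = α • (p - x) + (1 - α) • (q - y) := by
      module
    rw [e] at h
    have hsq : ‖α • (p - x) + (1 - α) • (q - y)‖ ^ 2
        ≤ α * ‖p - x‖ ^ 2 + (1 - α) * ‖q - y‖ ^ 2 := by
      have h1 := norm_add_le (α • (p - x)) ((1 - α) • (q - y))
      rw [norm_smul, norm_smul, Real.norm_of_nonneg hα, Real.norm_of_nonneg hβ] at h1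
      have h2 := pow_le_pow_left₀ (norm_nonneg _) h1 2
      nlinarith [mul_nonneg (mul_nonneg hα hβ) (sq_nonneg (‖p - x‖ - ‖q - y‖))]
    simp only [smul_eq_mul]
    rw [hp, hq]
    linarith
  · obtain ⟨p, a, ha, hp, -⟩ := f.exists_env_prox x
    refine ⟨x - p, fun z => ?_⟩
    have h := f.env_le_of_le ha.le z
    have e : p - z = -((z - x) + (x - p)) := by abel
    rw [e, norm_neg, norm_add_sq_real, real_inner_comm] at h
    rw [hp, norm_sub_rev p x]
    linarith

/-- Affine minorants of a function in `Γ₀(ℝⁿ)` that nearly touch it at a given point. -/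
theorem exists_affine_minorant {y : Rn n} {c : ℝ} (hc : (c : EReal) < f.toFun y) :
    ∃ w : Rn n, ∀ z, ((c + inner ℝ w (z - y) : ℝ) : EReal) ≤ f.toFun z := by
  obtain ⟨δ, hδ, hball⟩ := Metric.eventually_nhds_iff.1 (f.lsc y c hc)
  obtain ⟨C, k, hC, hk, hf⟩ := f.exists_linear_lower_bound y
  -- So large that `hpc` holds: if `p` is within `δ` of `y`, semicontinuity gives `f p > c`;
  -- otherwise the penalty beats the linear decay.
  set μ : ℝ := (k + (|c| + C) / δ) / δ + 1 with hμ
  have hμ0 : 0 < μ := by positivity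
  obtain ⟨p, a, ha, hp⟩ := f.exists_prox (half_pos hμ0) y
  have hpc : c ≤ a + μ * ‖p - y‖ ^ 2 := by
    by_cases hpy : ‖p - y‖ < δ
    · have h1 : (c : EReal) < f.toFun p := hball (by rwa [dist_eq_norm] : dist p y < δ)
      rw [ha] at h1
      have : c < a := by exact_mod_cast h1
      nlinarith [sq_nonneg ‖p - y‖]
    · push Not at hpy
      have h1 := hf p
      rw [ha] at h1
      have h2 : -C - k * ‖p - y‖ ≤ a := by exact_mod_cast h1
      set t := ‖p - y‖
      have h3 : k + (|c| + C) / δ ≤ μ * δ := by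
        rw [hμ, add_mul, div_mul_cancel₀ _ hδ.ne']; linarith
      have h4 : (k + (|c| + C) / δ) * t ≤ μ * t * t := by
        have := mul_le_mul_of_nonneg_left hpy hμ0.le
        exact mul_le_mul_of_nonneg_right (h3.trans this) (hδ.le.trans hpy)
      have h5 : |c| + C ≤ (|c| + C) / δ * t := by
        have := mul_le_mul_of_nonneg_left hpy (by positivity : 0 ≤ (|c| + C) / δ)
        rwa [div_mul_cancel₀ _ hδ.ne'] at this
      have := le_abs_self c
      nlinarith
  -- This is a subgradient at the proximal point `p`: compare `p` with `s • z + (1 - s) • p` and let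
  -- `s → 0`.
  refine ⟨μ • (y - p), fun z => ?_⟩
  by_cases htop : f.toFun z < ⊤
  swap
  · rw [not_lt_top_iff.1 htop]; exact le_top
  obtain ⟨b, hb⟩ := f.exists_coe_eq htop
  have hsub : a + μ * inner ℝ (y - p) (z - p) ≤ b := by
    have hs : ∀ s ∈ Set.Ioc (0 : ℝ) 1,
        a + μ * inner ℝ (y - p) (z - p) ≤ b + s * (μ / 2 * ‖z - p‖ ^ 2) := by
      rintro s ⟨hs0, hs1⟩
      have h1 := hp (s • z + (1 - s) • p)
      have h2 := h1.trans (add_le_add_left (f.le_combo hb.le ha.le hs0.le hs1) _)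
      have e : s • z + (1 - s) • p - y = s • (z - p) - (y - p) := by module
      rw [e] at h2
      have h3 : a + μ / 2 * ‖p - y‖ ^ 2
          ≤ s * b + (1 - s) * a + μ / 2 * ‖s • (z - p) - (y - p)‖ ^ 2 := by exact_mod_cast h2
      rw [norm_sub_sq_real (s • (z - p)), norm_smul, real_inner_smul_left, real_inner_comm,
        norm_sub_rev p y, Real.norm_of_nonneg hs0.le] at h3
      refine le_of_mul_le_mul_left ?_ hs0
      linear_combination h3
    refine le_of_forall_pos_le_add fun ε hε => ?_
    have hK : 0 ≤ μ / 2 * ‖z - p‖ ^ 2 := by positivity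
    set K := μ / 2 * ‖z - p‖ ^ 2
    have h1 := hs (min 1 (ε / (K + 1))) ⟨by positivity, min_le_left _ _⟩
    have h2 : min 1 (ε / (K + 1)) * K ≤ ε := by
      have h3 := mul_le_mul_of_nonneg_right (min_le_right 1 (ε / (K + 1))) hK
      have h4 : ε / (K + 1) * K ≤ ε := by
        rw [div_mul_eq_mul_div, div_le_iff₀ (by linarith)]
        nlinarith
      linarith
    linarith
  rw [hb]
  norm_cast
  have e : z - p = (z - y) + (y - p) := by abel
  rw [e, inner_add_right, real_inner_self_eq_norm_sq, norm_sub_rev y p] at hsub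
  rw [real_inner_smul_left]
  linarith

/-- For an affine minorant of slope `w`, the proximal point of `y + w` is `y`, so its envelope there
is `c + ‖w‖²/2`. -/
theorem exists_le_env_sub {y : Rn n} {c : ℝ} (hc : (c : EReal) < f.toFun y) :
    ∃ x, c ≤ f.env x - 1 / 2 * ‖x - y‖ ^ 2 := by
  obtain ⟨w, hw⟩ := f.exists_affine_minorant hc
  refine ⟨y + w, ?_⟩
  obtain ⟨p, a, ha, hp, -⟩ := f.exists_env_prox (y + w)
  have h := hw p
  rw [ha] at h
  have h1 : c + inner ℝ w (p - y) ≤ a := by exact_mod_cast h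
  have e : p - (y + w) = (p - y) - w := by abel
  rw [e, norm_sub_sq_real, real_inner_comm] at hp
  rw [hp, add_sub_cancel_left]
  nlinarith [sq_nonneg ‖p - y‖]

theorem env_sub_le (x y : Rn n) : ((f.env x - 1 / 2 * ‖x - y‖ ^ 2 : ℝ) : EReal) ≤ f.toFun y := by
  by_cases htop : f.toFun y < ⊤
  swap
  · rw [not_lt_top_iff.1 htop]; exact le_top
  obtain ⟨b, hb⟩ := f.exists_coe_eq htop
  have := f.env_le_of_le hb.le x
  rw [norm_sub_rev] at this
  rw [hb]
  norm_cast
  linarith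

theorem env_injective : Function.Injective (env : Gamma0 n → Rn n → ℝ) := by
  have key : ∀ f g : Gamma0 n, f.env = g.env → ∀ y, f.toFun y ≤ g.toFun y := by
    intro f g h y
    refine EReal.ge_of_forall_gt_iff_ge.1 fun c hc => ?_
    obtain ⟨x, hx⟩ := f.exists_le_env_sub hc
    rw [h] at hx
    exact (EReal.coe_le_coe_iff.2 hx).trans (g.env_sub_le x y)
  intro f g h
  ext y
  exact le_antisymm (key f g h y) (key g f h.symm y)

end Gamma0

namespace IsMoreauEnv

variable {n : ℕ} {φ : Rn n → ℝ}

/-- The inversion formula defines `F`. The touching condition at `x` says that the supremum at `p =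
x - v` is attained at `x`, which makes the envelope of `F` at `x` at most `φ x`. -/
theorem exists_env_eq (hφ : IsMoreauEnv φ) : ∃ f : Gamma0 n, f.env = φ := by
  set F : Rn n → EReal := fun y => ⨆ x, ((φ x - 1 / 2 * ‖x - y‖ ^ 2 : ℝ) : EReal) with hF
  have hle : ∀ x y, ((φ x - 1 / 2 * ‖x - y‖ ^ 2 : ℝ) : EReal) ≤ F y := fun x y =>
    le_iSup (fun x => ((φ x - 1 / 2 * ‖x - y‖ ^ 2 : ℝ) : EReal)) x
  have hbot : ∀ y, F y ≠ ⊥ := fun y => ((EReal.bot_lt_coe _).trans_le (hle y y)).ne'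
  have hup : ∀ x, ∃ p, F p ≤ ((φ x - 1 / 2 * ‖x - p‖ ^ 2 : ℝ) : EReal) := by
    intro x
    obtain ⟨v, hv⟩ := hφ.touch x
    refine ⟨x - v, iSup_le fun z => ?_⟩
    norm_cast
    have e : z - (x - v) = (z - x) + v := by abel
    rw [e, norm_add_sq_real, sub_sub_cancel, real_inner_comm]
    linarith [hv z]
  let f : Gamma0 n :=
    { toFun := F
      proper := ⟨hbot, by
        obtain ⟨p, hp⟩ := hup 0
        exact ⟨p, hp.trans_lt (EReal.coe_lt_top _)⟩⟩
      lsc := lowerSemicontinuous_iSup fun x => Continuous.lowerSemicontinuous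
        (continuous_coe_real_ereal.comp (by fun_prop))
      convex := by
        intro y z hy hz α hα0 hα1
        have hy' := EReal.coe_toReal hy.ne (hbot y)
        have hz' := EReal.coe_toReal hz.ne (hbot z)
        set a := (F y).toReal
        set b := (F z).toReal
        rw [← hy', ← hz']
        refine iSup_le fun x => ?_
        norm_cast
        -- For a fixed displacement `u`, the map `y ↦ φ (y + u) - ‖u‖²/2` is convex, and `F` is the
        -- supremum of these over `u`.
        set u := x - (α • y + (1 - α) • z) with hu
        have h1 := hle (y + u) y
        have h2 := hle (z + u) z
        rw [← hy', add_sub_cancel_left] at h1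
        rw [← hz', add_sub_cancel_left] at h2
        have h1 : φ (y + u) - 1 / 2 * ‖u‖ ^ 2 ≤ a := by exact_mod_cast h1
        have h2 : φ (z + u) - 1 / 2 * ‖u‖ ^ 2 ≤ b := by exact_mod_cast h2
        have h3 := hφ.convex.2 (Set.mem_univ (y + u)) (Set.mem_univ (z + u)) hα0
          (sub_nonneg.2 hα1) (add_sub_cancel α 1)
        have e : α • (y + u) + (1 - α) • (z + u) = x := by rw [hu]; module
        rw [e] at h3
        simp only [smul_eq_mul] at h3
        have h4 := mul_le_mul_of_nonneg_left h1 hα0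
        have h5 := mul_le_mul_of_nonneg_left h2 (sub_nonneg.2 hα1)
        linarith }
  refine ⟨f, funext fun x => le_antisymm ?_ ?_⟩
  · obtain ⟨p, hp⟩ := hup x
    have := f.env_le_of_le (z := p) hp x
    rw [norm_sub_rev] at this
    linarith
  · obtain ⟨p, a, ha, hp, -⟩ := f.exists_env_prox x
    have h := hle x p
    rw [show F p = a from ha] at h
    have h1 : φ x - 1 / 2 * ‖x - p‖ ^ 2 ≤ a := by exact_mod_cast h
    rw [hp, norm_sub_rev p x]
    linarith

end IsMoreauEnv

/-! ### Limits and lower bounds of envelopes. -/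

namespace IsMoreauEnv

variable {n : ℕ} {φ : Rn n → ℝ}

theorem continuous (hφ : IsMoreauEnv φ) : Continuous φ := hφ.convex.locallyLipschitz.continuous

theorem of_tendsto {ψ : ℕ → Rn n → ℝ} (hψ : ∀ k, IsMoreauEnv (ψ k))
    (h : ∀ x, Tendsto (fun k => ψ k x) atTop (𝓝 (φ x))) : IsMoreauEnv φ := by
  refine ⟨⟨convex_univ, fun x _ y _ α β hα hβ hαβ => ?_⟩, fun x => ?_⟩
  · exact le_of_tendsto_of_tendsto' (h _) (((h x).const_mul α).add ((h y).const_mul β))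
      fun k => (hψ k).convex.2 (Set.mem_univ x) (Set.mem_univ y) hα hβ hαβ
  · choose v hv using fun k => (hψ k).touch x
    -- Testing at `x ± e i` bounds each coordinate of the slopes `v k`; a convergent subsequence
    -- then gives the slope of the limit.
    set e : Fin n → Rn n := fun i => EuclideanSpace.single i 1 with he
    have hne : ∀ i, ‖e i‖ = 1 := fun i => by simp [he]
    have hin : ∀ k i, inner ℝ (v k) (e i) = v k i := fun k i => by
      rw [he, EuclideanSpace.inner_single_right]
      simp
    have hub : ∀ i, ∃ B, ∀ k, v k i ≤ B := by
      intro i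
      obtain ⟨B, hB⟩ := ((h x).sub (h (x - e i))).bddAbove_range
      refine ⟨B + 1 / 2, fun k => ?_⟩
      have h1 := hv k (x - e i)
      have h2 : ψ k x - ψ k (x - e i) ≤ B := hB ⟨k, rfl⟩
      rw [sub_sub_cancel_left, inner_neg_right, norm_neg, hne, hin] at h1
      linarith
    have hlb : ∀ i, ∃ B, ∀ k, B ≤ v k i := by
      intro i
      obtain ⟨B, hB⟩ := ((h (x + e i)).sub (h x)).bddBelow_range
      refine ⟨B - 1 / 2, fun k => ?_⟩
      have h1 := hv k (x + e i)
      have h2 : B ≤ ψ k (x + e i) - ψ k x := hB ⟨k, rfl⟩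
      rw [add_sub_cancel_left, hne, hin] at h1
      linarith
    choose u hu using hub
    choose l hl using hlb
    have hcomp : IsCompact ((EuclideanSpace.equiv (Fin n) ℝ).toHomeomorph ⁻¹'
        Set.univ.pi fun i => Set.Icc (l i) (u i)) :=
      (EuclideanSpace.equiv (Fin n) ℝ).toHomeomorph.isCompact_preimage.2
        (isCompact_univ_pi fun i => isCompact_Icc)
    obtain ⟨w, -, s, hs, hw⟩ := hcomp.tendsto_subseq (x := v) fun k i _ => ⟨hl i k, hu i k⟩
    refine ⟨w, fun z => ?_⟩
    refine le_of_tendsto_of_tendsto' ((h z).comp hs.tendsto_atTop)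
      ((((h x).comp hs.tendsto_atTop).add (hw.inner tendsto_const_nhds)).add_const _)
      fun k => hv (s k) z

/-- Up to an affine term, an envelope is bounded below by an arbitrarily flat paraboloid. -/
theorem exists_lower_bound (hφ : IsMoreauEnv φ) :
    ∃ v : Rn n, ∀ τ : ℝ, 0 < τ → ∀ x, φ 0 + inner ℝ v x - τ / 2 * ‖x‖ ^ 2 ≤ φ x := by
  obtain ⟨v, hv⟩ := hφ.touch 0
  refine ⟨v, fun τ hτ x => ?_⟩
  -- The origin lies between `x` and `-τ x`: the upper bound at `-τ x` becomes a lower bound at `x`,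
  -- with `v` independent of `τ`.
  have h1 := hv (-(τ • x))
  rw [sub_zero, inner_neg_right, real_inner_smul_right, norm_neg, norm_smul,
    Real.norm_of_nonneg hτ.le] at h1
  have h2 := hφ.convex.2 (Set.mem_univ x) (Set.mem_univ (-(τ • x)))
    (by positivity : 0 ≤ τ / (1 + τ)) (by positivity : 0 ≤ 1 / (1 + τ)) (by field_simp; ring)
  have e : (τ / (1 + τ)) • x + (1 / (1 + τ)) • (-(τ • x)) = 0 := by
    rw [smul_neg, smul_smul, ← sub_eq_add_neg, ← sub_smul]
    convert zero_smul ℝ x using 2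
    ring
  rw [e, smul_eq_mul, smul_eq_mul] at h2
  have h3 : (1 + τ) * φ 0 ≤ τ * φ x + φ (-(τ • x)) := by
    have h4 := mul_le_mul_of_nonneg_left h2 (by positivity : 0 ≤ 1 + τ)
    have e2 : (1 + τ) * (τ / (1 + τ) * φ x + 1 / (1 + τ) * φ (-(τ • x)))
        = τ * φ x + φ (-(τ • x)) := by field_simp
    linarith
  refine le_of_mul_le_mul_left ?_ hτ
  linear_combination h3 + h1

end IsMoreauEnv

/-! ### Wells and strong minima. -/

/-- Convex combination of `φ` with `‖x‖² / 4`, the Moreau envelope of `‖x‖² / 2`. -/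
noncomputable def quadMix {n : ℕ} (s : ℝ) (φ : Rn n → ℝ) (x : Rn n) : ℝ :=
  (1 - s) * φ x + s * (1 / 4 * ‖x‖ ^ 2)

/-- At some point `z` and for some `η > 0`, `φ` exceeds `φ z` by at least `η` on the sphere of
radius `r` around `z`. -/
def HasWell {n : ℕ} (φ : Rn n → ℝ) (r : ℝ) : Prop :=
  ∃ z, ∃ η > 0, ∀ x, ‖x - z‖ = r → φ z + η ≤ φ x

theorem norm_combo_sq {E : Type*} [NormedAddCommGroup E] [InnerProductSpace ℝ E] (x y : E)
    {α β : ℝ} (h : α + β = 1) :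
    ‖α • x + β • y‖ ^ 2 = α * ‖x‖ ^ 2 + β * ‖y‖ ^ 2 - α * β * ‖x - y‖ ^ 2 := by
  obtain rfl : β = 1 - α := by linarith
  rw [norm_add_sq_real, norm_sub_sq_real, real_inner_smul_left, real_inner_smul_right, norm_smul,
    norm_smul, mul_pow, mul_pow, Real.norm_eq_abs, Real.norm_eq_abs, sq_abs, sq_abs]
  ring

namespace IsMoreauEnv

variable {n : ℕ} {φ : Rn n → ℝ}

theorem quadMix_combo_le (hφ : IsMoreauEnv φ) {s : ℝ} (hs1 : s ≤ 1) (x y : Rn n)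
    {α β : ℝ} (hα : 0 ≤ α) (hβ : 0 ≤ β) (h : α + β = 1) :
    quadMix s φ (α • x + β • y)
      ≤ α * quadMix s φ x + β * quadMix s φ y - s / 4 * (α * β) * ‖x - y‖ ^ 2 := by
  have h1 := hφ.convex.2 (Set.mem_univ x) (Set.mem_univ y) hα hβ h
  simp only [smul_eq_mul] at h1
  have h2 := mul_le_mul_of_nonneg_left h1 (sub_nonneg.2 hs1)
  unfold quadMix
  rw [norm_combo_sq x y h]
  linear_combination h2

theorem quadMix (hφ : IsMoreauEnv φ) {s : ℝ} (hs0 : 0 ≤ s) (hs1 : s ≤ 1) :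
    IsMoreauEnv (quadMix s φ) := by
  refine ⟨⟨convex_univ, fun x _ y _ α β hα hβ h => ?_⟩, fun x => ?_⟩
  · have h1 := hφ.quadMix_combo_le hs1 x y hα hβ h
    have h2 : 0 ≤ s / 4 * (α * β) * ‖x - y‖ ^ 2 := by positivity
    simp only [smul_eq_mul]
    linarith
  · obtain ⟨v, hv⟩ := hφ.touch x
    refine ⟨(1 - s) • v + (s / 2) • x, fun z => ?_⟩
    have h1 := mul_le_mul_of_nonneg_left (hv z) (sub_nonneg.2 hs1)
    have h2 : ‖z‖ ^ 2 = ‖x‖ ^ 2 + 2 * inner ℝ x (z - x) + ‖z - x‖ ^ 2 := by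
      rw [← norm_add_sq_real, add_sub_cancel]
    have h3 := mul_nonneg hs0 (sq_nonneg ‖z - x‖)
    unfold _root_.quadMix
    rw [inner_add_left, real_inner_smul_left, real_inner_smul_left, h2]
    linear_combination h1 + h3 / 4

theorem bddBelow_quadMix (hφ : IsMoreauEnv φ) {s : ℝ} (hs0 : 0 < s) (hs1 : s ≤ 1) :
    BddBelow (Set.range (_root_.quadMix s φ)) := by
  obtain ⟨v, hv⟩ := hφ.exists_lower_bound
  refine ⟨(1 - s) * φ 0 - 4 / s * ‖v‖ ^ 2, ?_⟩
  rintro _ ⟨x, rfl⟩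
  -- With `τ = s/4` the paraboloid costs at most `s/8 * ‖x‖²`, leaving `s/8 * ‖x‖²` to absorb the
  -- linear term.
  have h1 := mul_le_mul_of_nonneg_left (hv (s / 4) (by linarith) x) (sub_nonneg.2 hs1)
  have h2 : -(‖v‖ * ‖x‖) ≤ inner ℝ v x := neg_le_of_abs_le (abs_real_inner_le_norm v x)
  have h3 := mul_le_mul_of_nonneg_left h2 (sub_nonneg.2 hs1)
  have h4 : ‖v‖ * ‖x‖ ≤ 4 / s * ‖v‖ ^ 2 + s / 8 * ‖x‖ ^ 2 := by
    have h5 : 0 ≤ 2 / s * (‖v‖ - s / 4 * ‖x‖) ^ 2 := by positivity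
    have h6 : 0 ≤ 2 / s * ‖v‖ ^ 2 := by positivity
    have e : 2 / s * (‖v‖ - s / 4 * ‖x‖) ^ 2
        = 2 / s * ‖v‖ ^ 2 - ‖v‖ * ‖x‖ + s / 8 * ‖x‖ ^ 2 := by field_simp; ring
    have e2 : 4 / s * ‖v‖ ^ 2 = 2 / s * ‖v‖ ^ 2 + 2 / s * ‖v‖ ^ 2 := by ring
    linarith
  have h5 : (1 - s) * (‖v‖ * ‖x‖) ≤ ‖v‖ * ‖x‖ :=
    mul_le_of_le_one_left (by positivity) (by linarith)
  have h6 : 0 ≤ s ^ 2 * ‖x‖ ^ 2 := by positivity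
  unfold _root_.quadMix
  nlinarith

/-- Take `z` within `s r²/32` of the infimum. The midpoint of `z` and `x` is no lower than the
infimum, while strong convexity gains `s r²/16` there. -/
theorem hasWell_quadMix (hφ : IsMoreauEnv φ) {s r : ℝ} (hs0 : 0 < s) (hs1 : s ≤ 1) (hr : 0 < r) :
    HasWell (_root_.quadMix s φ) r := by
  have hbdd := hφ.bddBelow_quadMix hs0 hs1
  have hη : 0 < s * r ^ 2 / 32 := by positivity
  obtain ⟨z, hz⟩ := exists_lt_of_ciInf_lt
    (lt_add_of_pos_right (⨅ x, _root_.quadMix s φ x) hη)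
  refine ⟨z, s * r ^ 2 / 16, by positivity, fun x hx => ?_⟩
  have h1 := hφ.quadMix_combo_le hs1 x z (α := 1 / 2) (β := 1 / 2) (by norm_num) (by norm_num)
    (by norm_num)
  have h2 := ciInf_le hbdd ((1 / 2 : ℝ) • x + (1 / 2 : ℝ) • z)
  rw [hx] at h1
  linarith

end IsMoreauEnv

theorem ConvexOn.le_of_well {E : Type*} [NormedAddCommGroup E] [NormedSpace ℝ E] {φ : E → ℝ}
    (hφ : ConvexOn ℝ Set.univ φ) {z : E} {η r : ℝ} (hη : 0 < η) (hr : 0 < r)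
    (hz : ∀ x, ‖x - z‖ = r → φ z + η ≤ φ x) {x : E} (hx : r ≤ ‖x - z‖) : φ z + η ≤ φ x := by
  have hx0 : 0 < ‖x - z‖ := hr.trans_le hx
  set t := r / ‖x - z‖ with ht
  have ht0 : 0 < t := by positivity
  have ht1 : t ≤ 1 := (div_le_one hx0).2 hx
  have h1 := hz (t • x + (1 - t) • z) (by
    have e : t • x + (1 - t) • z - z = t • (x - z) := by module
    rw [e, norm_smul, Real.norm_of_nonneg ht0.le, ht, div_mul_cancel₀ _ hx0.ne'])
  have h2 := hφ.2 (Set.mem_univ x) (Set.mem_univ z) ht0.le (sub_nonneg.2 ht1) (by ring)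
  simp only [smul_eq_mul] at h2
  refine le_of_mul_le_mul_left ?_ ht0
  nlinarith

theorem Gamma0.exists_attainsStrongMinAt {n : ℕ} (f : Gamma0 n)
    (hf : ∀ m : ℕ, HasWell f.env (1 / ((m : ℝ) + 1))) : ∃ a, AttainsStrongMinAt f.toFun a := by
  have hE := f.isMoreauEnv_env
  have hpos : ∀ m : ℕ, 0 < 1 / ((m : ℝ) + 1) := fun m => Nat.one_div_pos_of_nat
  obtain ⟨a, ha⟩ : ∃ a, ∀ x, f.env a ≤ f.env x := by
    obtain ⟨z, η, hη, hz⟩ := hf 0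
    obtain ⟨a, -, ha⟩ := (isCompact_closedBall z (1 / (((0 : ℕ) : ℝ) + 1))).exists_isMinOn
      (Metric.nonempty_closedBall.2 (hpos 0).le) hE.continuous.continuousOn
    refine ⟨a, fun x => ?_⟩
    by_cases hx : x ∈ Metric.closedBall z (1 / (((0 : ℕ) : ℝ) + 1))
    · exact ha hx
    · rw [Metric.mem_closedBall, dist_eq_norm, not_le] at hx
      have h1 := hE.convex.le_of_well hη (hpos 0) hz hx.le
      have h2 : f.env a ≤ f.env z := ha (Metric.mem_closedBall_self (hpos 0).le)
      linarith
  have henv : ∀ {x : Rn n} {b : ℝ}, f.toFun x = b → f.env x ≤ b := fun {x b} hx => by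
    simpa using f.env_le_of_le hx.le x
  obtain ⟨p, b, hb, hp, -⟩ := f.exists_env_prox a
  -- A minimizer of the envelope is its own proximal point, since `f.env a = b + ‖p - a‖²/2` and
  -- `f.env a ≤ f.env p ≤ b`.
  have hpa : p = a := by
    have h1 := ha p
    have h2 := henv hb
    have h3 : ‖p - a‖ ^ 2 = 0 := le_antisymm (by linarith) (sq_nonneg _)
    rwa [sq_eq_zero_iff, norm_eq_zero, sub_eq_zero] at h3
  subst hpa
  have hpb : f.env p = b := by simpa using hp
  refine ⟨p, fun x hx => ?_, fun x hx => ?_⟩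
  · obtain ⟨c, hc⟩ := f.exists_coe_eq hx
    rw [hb, hc]
    exact_mod_cast hpb ▸ (ha x).trans (henv hc)
  · rw [hb] at hx
    refine Metric.tendsto_atTop'.2 fun ε hε => ?_
    obtain ⟨m, hm⟩ := exists_nat_one_div_lt (half_pos hε)
    obtain ⟨z, η, hη, hz⟩ := hf m
    -- Since `f.env ≤ f` and `b ≤ f.env z`, this applies to every `x k` with `f (x k) < b + η`, as
    -- well as to `p`.
    have hnear : ∀ y, f.env y < f.env z + η → ‖y - z‖ < 1 / ((m : ℝ) + 1) := fun y hy =>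
      lt_of_not_ge fun h => hy.not_ge (hE.convex.le_of_well hη (hpos m) hz h)
    have hpz := hnear p ((ha z).trans_lt (by linarith))
    have hlt : ((b : ℝ) : EReal) < ((b + η : ℝ) : EReal) := by
      norm_cast; linarith
    obtain ⟨N, hN⟩ := eventually_atTop.1 (hx.eventually_lt_const hlt)
    refine ⟨N, fun k hk => ?_⟩
    obtain ⟨c, hc⟩ := f.exists_coe_eq ((hN k hk.le).trans (EReal.coe_lt_top _))
    have h1 := hN k hk.le
    rw [hc] at h1
    have h2 : c < b + η := by exact_mod_cast h1
    have h3 := hnear (x k) (by linarith [henv hc, ha z])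
    rw [dist_eq_norm]
    have h4 := norm_sub_le_norm_sub_add_norm_sub (x k) z p
    rw [norm_sub_rev z p] at h4
    linarith

/-! ### The Attouch–Wets metric. -/

namespace Gamma0

variable {n : ℕ}

theorem abs_env_sub_le_envelopeSup (f g : Gamma0 n) {ρ : ℝ} {x : Rn n} (hx : ‖x‖ ≤ ρ) :
    |f.env x - g.env x| ≤ envelopeSup ρ f g := by
  have hb : BddAbove (Set.range fun x : Metric.closedBall (0 : Rn n) ρ =>
      |f.env x - g.env x|) := by
    have h := (isCompact_closedBall (0 : Rn n) ρ).bddAbove_image (f := fun x => |f.env x - g.env x|)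
      (f.isMoreauEnv_env.continuous.sub g.isMoreauEnv_env.continuous).abs.continuousOn
    rwa [Set.image_eq_range] at h
  exact le_ciSup hb ⟨x, by simpa using hx⟩

/-- `0 ≤ C` covers `ρ < 0`, where the supremum over the empty ball is 0. -/
theorem envelopeSup_le {f g : Gamma0 n} {ρ C : ℝ} (hC : 0 ≤ C)
    (h : ∀ x, ‖x‖ ≤ ρ → |f.env x - g.env x| ≤ C) : envelopeSup ρ f g ≤ C :=
  Real.iSup_le (fun x => h x (mem_closedBall_zero_iff.1 x.2)) hC

theorem envelopeSup_nonneg (ρ : ℝ) (f g : Gamma0 n) : 0 ≤ envelopeSup ρ f g :=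
  Real.iSup_nonneg fun _ => abs_nonneg _

theorem envelopeSup_self (ρ : ℝ) (f : Gamma0 n) : envelopeSup ρ f f = 0 :=
  le_antisymm (envelopeSup_le le_rfl fun x _ => by simp) (envelopeSup_nonneg _ _ _)

theorem envelopeSup_comm (ρ : ℝ) (f g : Gamma0 n) : envelopeSup ρ f g = envelopeSup ρ g f := by
  simp only [envelopeSup, abs_sub_comm]

theorem envelopeSup_triangle (ρ : ℝ) (f g h : Gamma0 n) :
    envelopeSup ρ f h ≤ envelopeSup ρ f g + envelopeSup ρ g h :=
  envelopeSup_le (add_nonneg (envelopeSup_nonneg _ _ _) (envelopeSup_nonneg _ _ _)) fun x hx =>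
    (abs_sub_le _ (g.env x) _).trans
      (add_le_add (abs_env_sub_le_envelopeSup f g hx) (abs_env_sub_le_envelopeSup g h hx))

theorem div_one_add_mono {s t : ℝ} (hs : 0 ≤ s) (hst : s ≤ t) : s / (1 + s) ≤ t / (1 + t) := by
  rw [div_le_div_iff₀ (by linarith) (by linarith)]
  linarith

theorem div_one_add_add_le {s t : ℝ} (hs : 0 ≤ s) (ht : 0 ≤ t) :
    (s + t) / (1 + (s + t)) ≤ s / (1 + s) + t / (1 + t) := by
  rw [add_div]
  gcongr <;> linarith

theorem div_one_add_le_one {t : ℝ} (ht : 0 ≤ t) : t / (1 + t) ≤ 1 :=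
  (div_le_one (by linarith)).2 (by linarith)

/-- The `k`-th summand of `attouchWetsDist`. -/
noncomputable def distTerm (f g : Gamma0 n) (k : ℕ) : ℝ :=
  1 / 2 ^ (k + 1) *
    (envelopeSup ((k + 1 : ℕ) : ℝ) f g / (1 + envelopeSup ((k + 1 : ℕ) : ℝ) f g))

theorem distTerm_nonneg (f g : Gamma0 n) (k : ℕ) : 0 ≤ distTerm f g k := by
  have := envelopeSup_nonneg ((k + 1 : ℕ) : ℝ) f g
  unfold distTerm
  positivity

theorem distTerm_le (f g : Gamma0 n) (k : ℕ) : distTerm f g k ≤ 1 / 2 ^ (k + 1) :=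
  mul_le_of_le_one_right (by positivity) (div_one_add_le_one (envelopeSup_nonneg _ _ _))

theorem summable_one_div_two_pow_succ : Summable fun k : ℕ => (1 : ℝ) / 2 ^ (k + 1) := by
  have h := (summable_nat_add_iff 1).2 summable_geometric_two
  simpa [one_div, inv_pow] using h

theorem summable_distTerm (f g : Gamma0 n) : Summable (distTerm f g) :=
  Summable.of_nonneg_of_le (distTerm_nonneg f g) (distTerm_le f g) summable_one_div_two_pow_succ

theorem distTerm_le_attouchWetsDist (f g : Gamma0 n) (k : ℕ) :
    distTerm f g k ≤ attouchWetsDist f g :=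
  (summable_distTerm f g).le_tsum k fun _ _ => distTerm_nonneg _ _ _

theorem attouchWetsDist_triangle (f g h : Gamma0 n) :
    attouchWetsDist f h ≤ attouchWetsDist f g + attouchWetsDist g h := by
  change ∑' k, distTerm f h k ≤ ∑' k, distTerm f g k + ∑' k, distTerm g h k
  rw [← (summable_distTerm f g).tsum_add (summable_distTerm g h)]
  refine (summable_distTerm f h).tsum_le_tsum (fun k => ?_)
    ((summable_distTerm f g).add (summable_distTerm g h))
  unfold distTerm
  rw [← mul_add]
  refine mul_le_mul_of_nonneg_left ?_ (by positivity)
  exact (div_one_add_mono (envelopeSup_nonneg _ _ _) (envelopeSup_triangle _ f g h)).trans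
    (div_one_add_add_le (envelopeSup_nonneg _ _ _) (envelopeSup_nonneg _ _ _))

/-- A single summand, of index `k ≥ ρ`, already controls the ball, as `t/(1+t)` is increasing. -/
theorem exists_envelopeSup_lt (ρ : ℝ) {ε : ℝ} (hε : 0 < ε) :
    ∃ δ > 0, ∀ f g : Gamma0 n, attouchWetsDist f g < δ →
      ∀ x, ‖x‖ ≤ ρ → |f.env x - g.env x| < ε := by
  obtain ⟨k, hk⟩ := exists_nat_ge ρ
  refine ⟨1 / 2 ^ (k + 1) * (ε / (1 + ε)), by positivity, fun f g h x hx => ?_⟩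
  have hx' : ‖x‖ ≤ ((k + 1 : ℕ) : ℝ) := by push_cast; linarith
  refine (abs_env_sub_le_envelopeSup f g hx').trans_lt (lt_of_not_ge fun hle => ?_)
  have h1 := (distTerm_le_attouchWetsDist f g k).trans_lt h
  exact h1.not_ge (mul_le_mul_of_nonneg_left (div_one_add_mono hε.le hle) (by positivity))

theorem eq_of_attouchWetsDist_eq_zero {f g : Gamma0 n} (h : attouchWetsDist f g = 0) : f = g := by
  refine env_injective (funext fun x => ?_)
  refine sub_eq_zero.1 (abs_eq_zero.1 (le_antisymm (le_of_forall_pos_le_add fun ε hε => ?_)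
    (abs_nonneg _)))
  obtain ⟨δ, hδ, H⟩ := exists_envelopeSup_lt (n := n) ‖x‖ hε
  rw [zero_add]
  exact (H f g (h ▸ hδ) x le_rfl).le

/-- The metric space structure given by the Attouch–Wets distance. -/
noncomputable abbrev attouchWetsMetricSpace (n : ℕ) : MetricSpace (Gamma0 n) where
  dist := attouchWetsDist
  dist_self f := by simp [attouchWetsDist, envelopeSup_self]
  dist_comm f g := by simp only [attouchWetsDist, envelopeSup_comm _ f g]
  dist_triangle := attouchWetsDist_triangle
  eq_of_dist_eq_zero := eq_of_attouchWetsDist_eq_zero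

/-! ### Completeness and genericity. -/

section

attribute [local instance] attouchWetsMetricSpace

theorem dist_eq_attouchWetsDist (f g : Gamma0 n) : dist f g = attouchWetsDist f g := rfl

/-- Locally uniform convergence of the envelopes implies convergence. -/
theorem tendsto_of_forall_ball {u : ℕ → Gamma0 n} {f : Gamma0 n}
    (h : ∀ ρ ε : ℝ, 0 < ε → ∀ᶠ k in atTop, ∀ x, ‖x‖ ≤ ρ → |(u k).env x - f.env x| ≤ ε) :
    Tendsto u atTop (𝓝 f) := by
  have hsup : ∀ ρ, Tendsto (fun k => envelopeSup ρ (u k) f) atTop (𝓝 0) := by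
    intro ρ
    refine Metric.tendsto_nhds.2 fun ε hε => ?_
    filter_upwards [h ρ (ε / 2) (half_pos hε)] with k hk
    rw [Real.dist_0_eq_abs, abs_of_nonneg (envelopeSup_nonneg _ _ _)]
    exact (envelopeSup_le (half_pos hε).le hk).trans_lt (half_lt_self hε)
  rw [tendsto_iff_dist_tendsto_zero]
  -- Each summand tends to 0 and is dominated by the geometric term.
  have key := tendsto_tsum_of_dominated_convergence (𝓕 := atTop)
    (f := fun k i => distTerm (u k) f i) (g := fun _ => (0 : ℝ))
    summable_one_div_two_pow_succ (fun i => ?_)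
    (Eventually.of_forall fun k i => by
      rw [Real.norm_of_nonneg (distTerm_nonneg _ _ _)]
      exact distTerm_le _ _ _)
  · rw [tsum_zero] at key
    exact key
  · have h1 := hsup ((i + 1 : ℕ) : ℝ)
    have h2 := (h1.div (h1.const_add 1) (by norm_num)).const_mul (1 / 2 ^ (i + 1) : ℝ)
    rw [zero_div, mul_zero] at h2
    exact h2

theorem completeSpace_attouchWets : CompleteSpace (Gamma0 n) := by
  refine Metric.complete_of_cauchySeq_tendsto fun u hu => ?_
  have hunif : ∀ ρ ε : ℝ, 0 < ε → ∃ N, ∀ j ≥ N, ∀ k ≥ N, ∀ x, ‖x‖ ≤ ρ →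
      |(u j).env x - (u k).env x| < ε := by
    intro ρ ε hε
    obtain ⟨δ, hδ, H⟩ := exists_envelopeSup_lt (n := n) ρ hε
    obtain ⟨N, hN⟩ := Metric.cauchySeq_iff.1 hu δ hδ
    exact ⟨N, fun j hj k hk => H _ _ (hN j hj k hk)⟩
  have hlim : ∀ x, ∃ a, Tendsto (fun k => (u k).env x) atTop (𝓝 a) := by
    refine fun x => cauchySeq_tendsto_of_complete (Metric.cauchySeq_iff.2 fun ε hε => ?_)
    obtain ⟨N, hN⟩ := hunif ‖x‖ ε hε
    exact ⟨N, fun j hj k hk => hN j hj k hk x le_rfl⟩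
  choose φ hφ using hlim
  obtain ⟨f, rfl⟩ := (IsMoreauEnv.of_tendsto (fun k => (u k).isMoreauEnv_env) hφ).exists_env_eq
  refine ⟨f, tendsto_of_forall_ball fun ρ ε hε => ?_⟩
  obtain ⟨N, hN⟩ := hunif ρ ε hε
  filter_upwards [eventually_ge_atTop N] with j hj x hx
  refine le_of_tendsto (tendsto_const_nhds.sub (hφ x)).abs ?_
  filter_upwards [eventually_ge_atTop N] with k hk
  exact (hN j hj k hk x hx).le

theorem isOpen_setOf_hasWell (r : ℝ) : IsOpen {f : Gamma0 n | HasWell f.env r} := by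
  refine Metric.isOpen_iff.2 ?_
  rintro f ⟨z, η, hη, hz⟩
  -- The ball contains `z` and the sphere around it; an error of `η/4` at each end leaves a well of
  -- depth `η/2`.
  obtain ⟨δ, hδ, H⟩ := exists_envelopeSup_lt (n := n) (‖z‖ + |r|) (by positivity : 0 < η / 4)
  refine ⟨δ, hδ, fun g hg => ⟨z, η / 2, half_pos hη, fun x hx => ?_⟩⟩
  have hx' : ‖x‖ ≤ ‖z‖ + |r| := by
    have := norm_le_norm_add_norm_sub' x z
    have := le_abs_self r
    linarith
  have h1 := abs_lt.1 (H g f hg x hx')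
  have h2 := abs_lt.1 (H g f hg z (by linarith [abs_nonneg r]))
  have h3 := hz x hx
  linarith [h1.1, h2.2]

theorem dense_setOf_hasWell {r : ℝ} (hr : 0 < r) : Dense {f : Gamma0 n | HasWell f.env r} := by
  intro f
  have hs0 : ∀ k : ℕ, 0 < 1 / ((k : ℝ) + 1) := fun k => Nat.one_div_pos_of_nat
  have hs1 : ∀ k : ℕ, 1 / ((k : ℝ) + 1) ≤ 1 := fun k => by
    rw [div_le_one (by positivity)]
    linarith [(Nat.cast_nonneg k : (0 : ℝ) ≤ k)]
  have hf := f.isMoreauEnv_env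
  choose u hu using fun k => (hf.quadMix (hs0 k).le (hs1 k)).exists_env_eq
  refine mem_closure_of_tendsto (f := u) (b := atTop) (tendsto_of_forall_ball fun ρ ε hε => ?_)
    (Eventually.of_forall fun k => ?_)
  -- `quadMix s φ - φ` is `s` times a fixed continuous function, hence small on balls.
  · obtain ⟨B, hB⟩ := (isCompact_closedBall (0 : Rn n) ρ).bddAbove_image
      (f := fun x => |1 / 4 * ‖x‖ ^ 2 - f.env x|)
      (by have := hf.continuous; fun_prop : Continuous _).continuousOn
    have hlim : Tendsto (fun k : ℕ => 1 / ((k : ℝ) + 1) * B) atTop (𝓝 0) := by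
      simpa using tendsto_one_div_add_atTop_nhds_zero_nat.mul_const B
    filter_upwards [hlim.eventually_lt_const hε] with k hk x hx
    have e : quadMix (1 / ((k : ℝ) + 1)) f.env x - f.env x
        = 1 / ((k : ℝ) + 1) * (1 / 4 * ‖x‖ ^ 2 - f.env x) := by
      unfold quadMix; ring
    rw [hu, e, abs_mul, abs_of_pos (hs0 k)]
    refine (mul_le_mul_of_nonneg_left ?_ (hs0 k).le).trans hk.le
    exact hB ⟨x, by simpa using hx, rfl⟩
  · change HasWell (u k).env r
    rw [hu]
    exact hf.hasWell_quadMix (hs0 k) (hs1 k) hr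

theorem isMeagre_compl_attainsStrongMin :
    IsMeagre {f : Gamma0 n | ∃ a : Rn n, AttainsStrongMinAt f.toFun a}ᶜ := by
  rw [IsMeagre, compl_compl]
  have h : (⋂ m : ℕ, {f : Gamma0 n | HasWell f.env (1 / ((m : ℝ) + 1))}) ∈ residual (Gamma0 n) :=
    countable_iInter_mem.2 fun m =>
      residual_of_dense_open (isOpen_setOf_hasWell _) (dense_setOf_hasWell Nat.one_div_pos_of_nat)
  exact mem_of_superset h fun f hf => f.exists_attainsStrongMinAt (Set.mem_iInter.1 hf)

end

end Gamma0

/-- The Attouch–Wets distance is a complete metric on `Γ₀(ℝⁿ)`, and in this metric space the set of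
functions that attain a strong minimum is generic: its complement is meagre. -/
theorem theorem4p14 (n : ℕ) :
    ∃ _ : MetricSpace (Gamma0 n),
      (∀ f g : Gamma0 n, dist f g = attouchWetsDist f g) ∧
      CompleteSpace (Gamma0 n) ∧
      IsMeagre {f : Gamma0 n | ∃ a : Rn n, AttainsStrongMinAt f.toFun a}ᶜ :=
  ⟨Gamma0.attouchWetsMetricSpace n, Gamma0.dist_eq_attouchWetsDist,
    Gamma0.completeSpace_attouchWets, Gamma0.isMeagre_compl_attainsStrongMin⟩
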